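/- Let $X$ be a finite-dimensional real inner product space, $B:X\rightrightarrows X$ a maximal monotone operator with $B^{-1}(0)\neq\emptyset$, and for $\varepsilon\ge 0$ let $B^{[\varepsilon]}(x)=\{v:\langle v-v',x-x'\rangle\ge-\varepsilon\ \text{ whenever } v'\in B(x')\}$. Let $x_0\in X$, let $d_0$ be the distance from $x_0$ to $B^{-1}(0)$, and let $\sigma\in[0,1)$, $\bar\lambda>0$, $\bar\rho>0$, $\bar\varepsilon>0$, $\rho\in(0,\bar\rho)$. Write $\log^+ t=\max\{\log t,0\}$ for $t>0$ and $\log^+0=0$. **Algorithm 2** with parameter $\mu>0$: starting with $k=1$, choose $\lambda_k>0$ and find $y_k,b_k\in X$, $\varepsilon_k\ge0$ with $$b_k\in B^{[\varepsilon_k]}(y_k),\qquad \|\lambda_k[b_k+\mu(y_k-x_0)]+y_k-x_{k-1}\|^2+2\lambda_k\varepsilon_k\le\sigma^2\|y_k-x_{k-1}\|^2 .$$ If $\|b_k+\mu(y_k-x_0)\|\le\rho$ and $\varepsilon_k\le\bar\varepsilon$, stop and output $(y_k,b_k,\varepsilon_k)$; otherwise set $x_k=x_{k-1}-\lambda_k[b_k+\mu(y_k-x_0)]$,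 increase $k$ by one and repeat. **DR-HPE**: start with $\mathcal D_0=\dfrac{2\bar\lambda(\bar\rho-\rho)}{(1-\sigma^2)(1+1/\sqrt{1-\sigma^2})}$. Call Algorithm 2 (started at $x_0$) with $\mu=\dfrac{\bar\rho-\rho}{(1+1/\sqrt{1-\sigma^2})\,\mathcal D_0}$ to obtain $(y,b,\varepsilon)$. If $\mu\|y-x_0\|\le\bar\rho-\rho$, stop and output $(y,b,\varepsilon)$; otherwise replace $\mathcal D_0$ by $2\mathcal D_0$ and call Algorithm 2 again. The iterations of all the calls of Algorithm 2 are the inner iterations. **Theorem 3.4.** For every $c$ there is a constant $C>0$ depending only on $c$ such that the following holds for all data as above with $(1-\sigma)^{-1}\le c$ and every $\underline\lambda>0$. If the stepsize in every inner iteration of DR-HPE is at least $\underline\lambda$, then, whatever the other choices in the inner iterations are, an inner iteration with stepsize at least $\underline\lambda$ can be performed as long as DR-HPE has not stopped, and DR-HPE stops with a triple $(y,b,\varepsilon)$ satisfying $$b\in B^{[\varepsilon]}(y),\qquad\|b\|\le\bar\rho,\qquad\varepsilon\le\bar\varepsilon$$ after at most $$C\left(1+\frac{\bar\lambda}{\underline\lambda}\right)\left(\frac{d_0}{\bar\lambda(\bar\rho-\rho)}+1\right)\left[1+\max\left\{\log^+\left(\frac{d_0}{\underline\lambda\rho}\right),\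 \log^+\left(\frac{d_0^2}{\underline\lambda\bar\varepsilon}\right)\right\}\right]$$ inner iterations in total. -/

import Mathlib

/-- A set-valued operator `A : X ⇉ X` is monotone. -/
def IsMonotoneOp {X : Type*} [NormedAddCommGroup X] [InnerProductSpace ℝ X]
    (A : X → Set X) : Prop :=
  ∀ x v x' v', v ∈ A x → v' ∈ A x' → 0 ≤ inner ℝ (v - v') (x - x')

/-- `A` is monotone and no monotone operator has a strictly larger graph. -/
def IsMaximalMonotoneOp {X : Type*} [NormedAddCommGroup X] [InnerProductSpace ℝ X]
    (A : X → Set X) : Prop :=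
  IsMonotoneOp A ∧ ∀ A' : X → Set X, IsMonotoneOp A' → (∀ x, A x ⊆ A' x) → A = A'

/-- The `ε`-enlargement `B^{[ε]}` of a set-valued operator `B`. -/
def enlargement {X : Type*} [NormedAddCommGroup X] [InnerProductSpace ℝ X]
    (B : X → Set X) (ε : ℝ) (x : X) : Set X :=
  {v | ∀ x' v', v' ∈ B x' → -ε ≤ inner ℝ (v - v') (x - x')}

/-- The solution set `B⁻¹(0)` of the inclusion `0 ∈ B x`. -/
def zeroSet {X : Type*} [NormedAddCommGroup X] (B : X → Set X) : Set X :=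
  {x | (0 : X) ∈ B x}

/-- Step 1 of the static `μ`-regularized HPE method at the current iterate `x`: a stepsize `lam`
and a triple `(y, b, ε)` which are acceptable for the relative error tolerance `σ`. -/
structure IsStaticChoice {X : Type*} [NormedAddCommGroup X] [InnerProductSpace ℝ X]
    (B : X → Set X) (x₀ : X) (σ μ : ℝ) (x : X) (lam : ℝ) (y b : X) (ε : ℝ) : Prop where
  lam_pos : 0 < lam
  eps_nonneg : 0 ≤ ε
  mem : b ∈ enlargement B ε y
  error : ‖lam • (b + μ • (y - x₀)) + y - x‖ ^ 2 + 2 * lam * ε ≤ σ ^ 2 * ‖y - x‖ ^ 2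

/-- What one iteration of the static method leads to: either a next iterate, or a stop with an
output triple. -/
inductive StaticState (X : Type*) where
  | iterate (x : X) : StaticState X
  | output (y b : X) (ε : ℝ) : StaticState X

/-- One iteration (steps 1 and 2) of the static `μ`-regularized HPE method with input
`(x₀, σ, μ, ρ, εtol)`, performed with stepsize `lam` at the current iterate `x`. The method starts
at the iterate `x₀`. The choices in step 1 are free, so this is a relation. -/
inductive StaticStep {X : Type*} [NormedAddCommGroup X] [InnerProductSpace ℝ X]
    (B : X → Set X) (x₀ : X) (σ μ ρ εtol : ℝ) (lam : ℝ) (x : X) : StaticState X → Prop where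
  | continue (y b : X) (ε : ℝ) (choice : IsStaticChoice B x₀ σ μ x lam y b ε)
      (test : ρ < ‖b + μ • (y - x₀)‖ ∨ εtol < ε) :
      StaticStep B x₀ σ μ ρ εtol lam x (.iterate (x - lam • (b + μ • (y - x₀))))
  | finish (y b : X) (ε : ℝ) (choice : IsStaticChoice B x₀ σ μ x lam y b ε)
      (test : ¬ (ρ < ‖b + μ • (y - x₀)‖ ∨ εtol < ε)) :
      StaticStep B x₀ σ μ ρ εtol lam x (.output y b ε)

/-- The input `(x₀, σ, lamBar, (rhoBar, epsBar), rho)` of the dynamic method. -/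
structure DRInput (X : Type*) where
  x₀ : X
  σ : ℝ
  lamBar : ℝ
  rhoBar : ℝ
  epsBar : ℝ
  rho : ℝ

namespace DRInput

/-- The domain of admissible inputs. -/
structure Valid {X : Type*} (P : DRInput X) : Prop where
  σ_nonneg : 0 ≤ P.σ
  σ_lt_one : P.σ < 1
  lamBar_pos : 0 < P.lamBar
  rhoBar_pos : 0 < P.rhoBar
  epsBar_pos : 0 < P.epsBar
  rho_pos : 0 < P.rho
  rho_lt : P.rho < P.rhoBar

/-- The regularization parameter `μ(D, ρ)` attached to the guess `D` for the distance `d₀`. -/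
noncomputable def mu {X : Type*} (P : DRInput X) (D : ℝ) : ℝ :=
  (P.rhoBar - P.rho) / ((1 + 1 / √(1 - P.σ ^ 2)) * D)

/-- The initial guess. -/
noncomputable def initGuess {X : Type*} (P : DRInput X) : ℝ :=
  2 * P.lamBar * (P.rhoBar - P.rho) / ((1 - P.σ ^ 2) * (1 + 1 / √(1 - P.σ ^ 2)))

end DRInput

/-- A state of the dynamic method between two inner iterations: `running D x` means that the
current call of the static method uses the guess `D` and its current iterate is `x`. -/
inductive DRState (X : Type*) where
  | running (D : ℝ) (x : X) : DRState X
  | output (y b : X) (ε : ℝ) : DRState X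

/-- The state in which the first call of the static method begins. -/
noncomputable def DRState.init {X : Type*} (P : DRInput X) : DRState X :=
  .running P.initGuess P.x₀

/-- One inner iteration of DR-HPE, performed with stepsize `lam`, together with the bookkeeping
which follows it: if the current call of the static method has not stopped, it goes on; if it has
stopped with `(y, b, ε)`, then either DR-HPE stops with that triple, or the guess is doubled and
a new call begins at `x₀`. -/
inductive DRStep {X : Type*} [NormedAddCommGroup X] [InnerProductSpace ℝ X]
    (B : X → Set X) (P : DRInput X) (lam : ℝ) : DRState X → DRState X → Prop where
  | inner (D : ℝ) (x x' : X)
      (call : StaticStep B P.x₀ P.σ (P.mu D) P.rho P.epsBar lam x (.iterate x')) :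
      DRStep B P lam (.running D x) (.running D x')
  | double (D : ℝ) (x y b : X) (ε : ℝ)
      (call : StaticStep B P.x₀ P.σ (P.mu D) P.rho P.epsBar lam x (.output y b ε))
      (test : ¬ (P.mu D * ‖y - P.x₀‖ ≤ P.rhoBar - P.rho)) :
      DRStep B P lam (.running D x) (.running (2 * D) P.x₀)
  | finish (D : ℝ) (x y b : X) (ε : ℝ)
      (call : StaticStep B P.x₀ P.σ (P.mu D) P.rho P.epsBar lam x (.output y b ε))
      (test : P.mu D * ‖y - P.x₀‖ ≤ P.rhoBar - P.rho) :
      DRStep B P lam (.running D x) (.output y b ε)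

/-- `DRExec B P lam n s`: DR-HPE with input `P` can perform `n` inner iterations in all (over all
calls of the static method), with the stepsizes `lam 0, …, lam (n - 1)` in this order, and
be in the state `s` afterwards. -/
inductive DRExec {X : Type*} [NormedAddCommGroup X] [InnerProductSpace ℝ X]
    (B : X → Set X) (P : DRInput X) (lam : ℕ → ℝ) : ℕ → DRState X → Prop where
  | start : DRExec B P lam 0 (DRState.init P)
  | step (n : ℕ) (s s' : DRState X) (prev : DRExec B P lam n s)
      (next : DRStep B P (lam n) s s') : DRExec B P lam (n + 1) s'

/-! Within one call the regularized inclusion `0 ∈ B x + μ • (x - x₀)` has a zero `xm`, by Minty's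
theorem, and monotonicity puts it within `d₀` of `x₀`. Testing the enlargement inequality against
`xm` shows that each inner iteration multiplies `‖x - xm‖ ^ 2` by at most `1 - θ`, where `1 / θ = 1
/ (1 - σ ^ 2) + 1 / (2 * l * μ)` (`IsStaticChoice.norm_sq_next_le`). An iteration that fails the
stopping test forces `‖x - xm‖` to be large (`IsStaticChoice.lt_of_test`), so a call lasts at most
about `1 / θ` times a logarithm.

For the `j`-th guess, `1 / θ` is at most a multiple of `2 ^ j`, so the calls cost `T * 2 ^ j` and
their costs sum geometrically. Trial points stay within a multiple of `d₀` of `x₀`, so the guess is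
doubled only while it is below `2 * d₀`; this bounds `2 ^ j`. The invariant `DRState.Bounded`
carries this count through an execution. Steps always exist because an exact proximal step is
acceptable. -/

/-! ### Maximal monotone operators and Minty's theorem -/

/-- A maximal monotone operator contains every point monotonically related to its graph. -/
theorem IsMaximalMonotoneOp.mem_of_forall {X : Type*} [NormedAddCommGroup X]
    [InnerProductSpace ℝ X] {B : X → Set X} (hB : IsMaximalMonotoneOp B) {x v : X}
    (h : ∀ x' v', v' ∈ B x' → 0 ≤ inner ℝ (v - v') (x - x')) : v ∈ B x := by
  have hmono : IsMonotoneOp (fun z => B z ∪ {w | z = x ∧ w = v}) := by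
    rintro a va b vb (ha | ⟨rfl, rfl⟩) (hb | ⟨rfl, rfl⟩)
    · exact hB.1 a va b vb ha hb
    · have := h a va ha
      rwa [← neg_sub va, ← neg_sub a, inner_neg_neg] at this
    · exact h b vb hb
    · simp
  have := hB.2 _ hmono (fun z => Set.subset_union_left)
  rw [this]
  exact Or.inr ⟨rfl, rfl⟩

/-- The zero set of a maximal monotone operator is closed. -/
theorem IsMaximalMonotoneOp.isClosed_zeroSet {X : Type*} [NormedAddCommGroup X]
    [InnerProductSpace ℝ X] {B : X → Set X} (hB : IsMaximalMonotoneOp B) :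
    IsClosed (zeroSet B) := by
  have : zeroSet B = ⋂ (x' : X) (v' : X) (_ : v' ∈ B x'),
      {x : X | 0 ≤ inner ℝ (0 - v') (x - x')} := by
    ext x
    simp only [Set.mem_iInter, Set.mem_ofPred_eq]
    exact ⟨fun hx x' v' hv => hB.1 _ _ _ _ hx hv, fun h => hB.mem_of_forall h⟩
  rw [this]
  refine isClosed_iInter fun x' => isClosed_iInter fun v' => isClosed_iInter fun _ => ?_
  exact isClosed_le continuous_const (by fun_prop)

/-- For a finite monotone family of pairs `(a i, v i)`, the inequalities
`⟪-y - v i, y - a i⟫ ≥ 0` have a common solution `y`. -/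
theorem exists_forall_inner_add_sub_nonpos {X : Type*} [NormedAddCommGroup X]
    [InnerProductSpace ℝ X] {ι : Type*} [Fintype ι] [Nonempty ι] (a v : ι → X)
    (h : ∀ i j, 0 ≤ inner ℝ (v i - v j) (a i - a j)) :
    ∃ y : X, ∀ i, inner ℝ (y + v i) (y - a i) ≤ 0 := by
  classical
  set w : ι → X := fun i => (2⁻¹ : ℝ) • (a i - v i) with hw
  set c : ι → ℝ := fun i => inner ℝ (v i) (a i) with hc
  -- Lagrangian dual function: `H t` is the minimum over `y` of the `t`-average of the forms `⟪y + v
  -- i, y - a i⟫ = ‖y‖ ^ 2 - 2 * ⟪y, w i⟫ - c i`, attained at `∑ i, t i • w i`.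
  set H : (ι → ℝ) → ℝ := fun t => -‖∑ i, t i • w i‖ ^ 2 - ∑ i, t i * c i with hH
  have hcont : Continuous H := by fun_prop
  obtain ⟨t, ht, hmax⟩ := (isCompact_stdSimplex ℝ ι).exists_isMaxOn
    (⟨_, single_mem_stdSimplex ℝ (Classical.arbitrary ι)⟩ : (stdSimplex ℝ ι).Nonempty)
    hcont.continuousOn
  set y : X := ∑ i, t i • w i with hy
  -- Averaged monotonicity gives `⟪va, aa⟫ ≤ ∑ i, t i * c i`, hence `H t ≤ -‖aa + va‖ ^ 2 / 4`.
  have hval : H t ≤ 0 := by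
    have hsum : 0 ≤ ∑ i, ∑ j, t i * t j * inner ℝ (v i - v j) (a i - a j) :=
      Finset.sum_nonneg fun i _ => Finset.sum_nonneg fun j _ =>
        mul_nonneg (mul_nonneg (ht.1 i) (ht.1 j)) (h i j)
    set va : X := ∑ i, t i • v i with hva
    set aa : X := ∑ i, t i • a i with haa
    have e1 : ∑ i, ∑ j, t i * t j * inner ℝ (v i - v j) (a i - a j)
        = 2 * ∑ i, t i * c i - 2 * inner ℝ va aa := by
      have e3 : inner ℝ va aa = ∑ i, ∑ j, t i * t j * inner ℝ (v j) (a i) := by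
        simp only [hva, haa, sum_inner, inner_sum, real_inner_smul_left, real_inner_smul_right,
          mul_assoc]
      have e2 : inner ℝ va aa = ∑ i, ∑ j, t i * t j * inner ℝ (v i) (a j) := by
        rw [e3, Finset.sum_comm]
        refine Finset.sum_congr rfl fun i _ => Finset.sum_congr rfl fun j _ => ?_
        rw [mul_comm (t j)]
      have e4 : ∑ i, t i * c i = ∑ i, ∑ j, t i * t j * c i := by
        refine Finset.sum_congr rfl fun i _ => ?_
        rw [← Finset.sum_mul, ← Finset.mul_sum, ht.2, mul_one]
      have e5 : ∑ i, t i * c i = ∑ i, ∑ j, t i * t j * c j := by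
        rw [e4, Finset.sum_comm]
        refine Finset.sum_congr rfl fun i _ => Finset.sum_congr rfl fun j _ => ?_
        ring
      rw [two_mul, two_mul]
      nth_rewrite 1 [e4]
      rw [e5]
      nth_rewrite 1 [e2]
      rw [e3]
      simp only [← Finset.sum_add_distrib, ← Finset.sum_sub_distrib]
      refine Finset.sum_congr rfl fun i _ => Finset.sum_congr rfl fun j _ => ?_
      simp only [hc, inner_sub_left, inner_sub_right]
      ring
    have e6 : y = (2⁻¹ : ℝ) • (aa - va) := by
      simp only [hy, hw, haa, hva, ← Finset.sum_sub_distrib, Finset.smul_sum]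
      refine Finset.sum_congr rfl fun i _ => ?_
      rw [smul_comm, smul_sub]
    have e7 : ‖y‖ ^ 2 = 4⁻¹ * ‖aa - va‖ ^ 2 := by
      rw [e6, norm_smul, mul_pow]; norm_num
    have e8 := norm_sub_sq_real aa va
    have e9 := norm_add_sq_real aa va
    rw [real_inner_comm] at e8 e9
    have e10 := sq_nonneg ‖aa + va‖
    change -‖y‖ ^ 2 - _ ≤ 0
    nlinarith
  refine ⟨y, fun i => ?_⟩
  set g : ℝ := inner ℝ (y + v i) (y - a i) with hg
  have hgval : g = ‖y‖ ^ 2 - 2 * inner ℝ y (w i) - c i := by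
    simp only [hg, hw, hc, inner_add_left, inner_sub_right, real_inner_smul_right,
      real_inner_self_eq_norm_sq, real_inner_comm y (v i)]
    ring
  -- First-order optimality of `t`: shifting mass `s` towards vertex `i` cannot increase `H`;
  -- letting `s` tend to `0` gives `g ≤ H t`.
  have key : ∀ s : ℝ, 0 < s → s ≤ 1 → g - H t ≤ s * ‖w i - y‖ ^ 2 := by
    intro s hs hs1
    have hmem : (1 - s) • t + s • Pi.single i (1 : ℝ) ∈ stdSimplex ℝ ι :=
      convex_stdSimplex ℝ ι ht (single_mem_stdSimplex ℝ i) (by linarith) hs.le (by ring)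
    have hle : H ((1 - s) • t + s • Pi.single i (1 : ℝ)) ≤ H t := hmax hmem
    have e1 : ∑ j, ((1 - s) • t + s • Pi.single i (1 : ℝ) : ι → ℝ) j • w j = y + s • (w i - y) := by
      simp only [Pi.add_apply, Pi.smul_apply, smul_eq_mul, add_smul, Finset.sum_add_distrib,
        mul_smul, ← Finset.smul_sum, Pi.single_apply, ite_smul, one_smul, zero_smul,
        Finset.sum_ite_eq', Finset.mem_univ, if_true, ← hy]
      module
    have e2 : ∑ j, ((1 - s) • t + s • Pi.single i (1 : ℝ) : ι → ℝ) j * c j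
        = (1 - s) * ∑ j, t j * c j + s * c i := by
      simp only [Pi.add_apply, Pi.smul_apply, smul_eq_mul, add_mul, Finset.sum_add_distrib,
        mul_assoc, ← Finset.mul_sum, Pi.single_apply, ite_mul, one_mul, zero_mul,
        Finset.sum_ite_eq', Finset.mem_univ, if_true]
    have hHt : H t = -‖y‖ ^ 2 - ∑ j, t j * c j := rfl
    have e3 : H ((1 - s) • t + s • Pi.single i (1 : ℝ))
        = -‖y + s • (w i - y)‖ ^ 2 - ((1 - s) * ∑ j, t j * c j + s * c i) := by
      rw [← e1, ← e2]
    rw [e3, norm_add_sq_real, norm_smul, mul_pow, real_inner_smul_right, inner_sub_right,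
      real_inner_self_eq_norm_sq, Real.norm_eq_abs, sq_abs, hHt] at hle
    have : s * (g - H t) ≤ s * (s * ‖w i - y‖ ^ 2) := by
      rw [hgval, hHt]; nlinarith
    exact le_of_mul_le_mul_left this hs
  have hlim : g - H t ≤ 0 := by
    have hN := sq_nonneg ‖w i - y‖
    by_contra! hpos
    set N := ‖w i - y‖ ^ 2
    set δ := g - H t
    have h1 := key 1 one_pos le_rfl
    have hNpos : 0 < N := by linarith
    have h2 := key (δ / (2 * N)) (by positivity) (by
      rw [div_le_one (by positivity)]; linarith)
    have : δ / (2 * N) * N = δ / 2 := by field_simp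
    linarith
  linarith

/-- **Minty's theorem** in finite dimension, for an operator which has a zero: the resolvent is
defined everywhere. -/
theorem IsMaximalMonotoneOp.exists_add_smul_eq {X : Type*} [NormedAddCommGroup X]
    [InnerProductSpace ℝ X] [FiniteDimensional ℝ X] {B : X → Set X}
    (hB : IsMaximalMonotoneOp B) (hne : (zeroSet B).Nonempty) {l : ℝ} (hl : 0 < l) (z : X) :
    ∃ y b : X, b ∈ B y ∧ y + l • b = z := by
  classical
  have : ProperSpace X := FiniteDimensional.proper ℝ X
  obtain ⟨p, hp⟩ := hne
  let G := {q : X × X // q.2 ∈ B q.1}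
  let S : G → Set X := fun q => {y | inner ℝ (y + (l • q.1.2 - z)) (y - q.1.1) ≤ 0}
  have hclosed : ∀ q, IsClosed (S q) := fun q =>
    isClosed_le (by fun_prop) continuous_const
  have hfin : ∀ u : Finset G,
      (Metric.closedBall p ‖z - p‖ ∩ ⋂ q ∈ u, S q).Nonempty := by
    intro u
    -- Adjoining the pair `(p, 0)` confines the solution to a fixed ball, which supplies the
    -- compactness.
    let q0 : G := ⟨(p, 0), hp⟩
    have : Nonempty (↥(insert q0 u)) := ⟨⟨q0, Finset.mem_insert_self _ _⟩⟩
    obtain ⟨y, hy⟩ := exists_forall_inner_add_sub_nonpos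
      (fun q : ↥(insert q0 u) => q.1.1.1) (fun q => l • q.1.1.2 - z) (by
        intro i j
        rw [sub_sub_sub_cancel_right, ← smul_sub, real_inner_smul_left]
        exact mul_nonneg hl.le (hB.1 _ _ _ _ i.1.2 j.1.2))
    refine ⟨y, ?_, ?_⟩
    · have h0 : inner ℝ (y + (l • (0 : X) - z)) (y - p) ≤ 0 :=
        hy ⟨q0, Finset.mem_insert_self _ _⟩
      have e : y + (l • (0 : X) - z) = (y - p) - (z - p) := by rw [smul_zero]; abel
      rw [e, inner_sub_left, real_inner_self_eq_norm_sq] at h0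
      have h1 := real_inner_le_norm (z - p) (y - p)
      rw [Metric.mem_closedBall, dist_eq_norm]
      by_contra! h2
      nlinarith [norm_nonneg (z - p)]
    · simp only [Set.mem_iInter]
      exact fun q hq => hy ⟨q, Finset.mem_insert_of_mem hq⟩
  obtain ⟨y, -, hy⟩ := (isCompact_closedBall p ‖z - p‖).inter_iInter_nonempty S hclosed hfin
  rw [Set.mem_iInter] at hy
  refine ⟨y, l⁻¹ • (z - y), hB.mem_of_forall fun x' v' hv => ?_, ?_⟩
  · have h1 : inner ℝ (y + (l • v' - z)) (y - x') ≤ 0 := hy ⟨(x', v'), hv⟩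
    have e : l⁻¹ • (z - y) - v' = (-l⁻¹) • (y + (l • v' - z)) := by
      have e' : v' = l⁻¹ • l • v' := (inv_smul_smul₀ hl.ne' v').symm
      nth_rewrite 1 [e']
      module
    rw [e, real_inner_smul_left]
    exact mul_nonneg_of_nonpos_of_nonpos (by simpa using hl.le) h1
  · rw [smul_inv_smul₀ hl.ne']; abel

/-! ### One iteration of the static method: contraction and stopping test -/

section StaticMethod

variable {X : Type*} [NormedAddCommGroup X] [InnerProductSpace ℝ X] {B : X → Set X}

/-- The solution of the `μ`-regularized inclusion is at least as close to the center `x₀` as any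
solution of the original one. -/
theorem IsMonotoneOp.norm_regularized_zero_sub_le (hB : IsMonotoneOp B) {x₀ xm p : X} {μ : ℝ}
    (hμ : 0 < μ) (hxm : -(μ • (xm - x₀)) ∈ B xm) (hp : p ∈ zeroSet B) :
    ‖xm - x₀‖ ≤ ‖p - x₀‖ := by
  have h := hB _ _ _ _ hxm hp
  have e : xm - p = (xm - x₀) - (p - x₀) := by abel
  rw [sub_zero, inner_neg_left, real_inner_smul_left, e, inner_sub_right,
    real_inner_self_eq_norm_sq] at h
  have h1 := real_inner_le_norm (xm - x₀) (p - x₀)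
  have h2 : ‖xm - x₀‖ ^ 2 - inner ℝ (xm - x₀) (p - x₀) ≤ 0 := by
    by_contra! h3
    nlinarith [mul_pos hμ h3]
  by_contra! h3
  nlinarith [norm_nonneg (p - x₀)]

/-- A maximal monotone operator with a zero has a regularized zero. -/
theorem IsMaximalMonotoneOp.exists_regularized_zero [FiniteDimensional ℝ X]
    (hB : IsMaximalMonotoneOp B) (hne : (zeroSet B).Nonempty) {μ : ℝ} (hμ : 0 < μ) (x₀ : X) :
    ∃ xm : X, -(μ • (xm - x₀)) ∈ B xm := by
  obtain ⟨y, b, hb, he⟩ := hB.exists_add_smul_eq hne (inv_pos.2 hμ) x₀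
  refine ⟨y, ?_⟩
  have : -(μ • (y - x₀)) = b := by
    rw [← he, sub_add_cancel_left, smul_neg, neg_neg, smul_inv_smul₀ hμ.ne']
  rwa [this]

/-- An exact proximal step is always acceptable, whatever the stepsize. -/
theorem IsMaximalMonotoneOp.exists_isStaticChoice [FiniteDimensional ℝ X]
    (hB : IsMaximalMonotoneOp B) (hne : (zeroSet B).Nonempty) {μ l : ℝ} (hμ : 0 < μ)
    (hl : 0 < l) (x₀ x : X) (σ : ℝ) :
    ∃ y b : X, IsStaticChoice B x₀ σ μ x l y b 0 := by
  have hs : 0 < 1 + l * μ := by positivity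
  -- This is `l • (b + μ • (y - x₀)) + y = x` solved for `y` and divided by `1 + l * μ`.
  obtain ⟨y, b, hb, he⟩ := hB.exists_add_smul_eq hne (div_pos hl hs)
    ((1 + l * μ)⁻¹ • (x + (l * μ) • x₀))
  refine ⟨y, b, hl, le_rfl, fun x' v' hv => ?_, ?_⟩
  · simpa using hB.1 _ _ _ _ hb hv
  · have h1 := congrArg (fun u => (1 + l * μ) • u) he
    simp only [smul_add, smul_smul] at h1
    rw [mul_div_cancel₀ _ hs.ne', mul_inv_cancel₀ hs.ne', one_smul] at h1
    have h0 : l • (b + μ • (y - x₀)) + y - x = 0 := by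
      have h2 := sub_eq_zero.2 h1
      rw [mul_inv_cancel_left₀ hs.ne'] at h2
      rw [← h2]
      module
    rw [h0]
    simp only [norm_zero]
    have := mul_nonneg (sq_nonneg σ) (sq_nonneg ‖y - x‖)
    linarith

variable {x₀ x y b xm : X} {σ μ lam ε : ℝ}

/-- Decrease of the squared distance to the regularized zero in one step. -/
theorem IsStaticChoice.norm_sq_next_add_le (hc : IsStaticChoice B x₀ σ μ x lam y b ε)
    (hxm : -(μ • (xm - x₀)) ∈ B xm) :
    ‖x - lam • (b + μ • (y - x₀)) - xm‖ ^ 2 + (1 - σ ^ 2) * ‖y - x‖ ^ 2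
      + 2 * lam * μ * ‖y - xm‖ ^ 2 ≤ ‖x - xm‖ ^ 2 := by
  obtain ⟨hl, -, hm, he⟩ := hc
  have h1 := hm _ _ hxm
  set u := y - xm with hu
  set w := y - x with hw
  set v := b + μ • (y - x₀) with hv
  have e1 : b - -(μ • (xm - x₀)) = v - μ • u := by rw [hv, hu]; module
  have e2 : x - lam • v - xm = u - (lam • v + w) := by rw [hu, hw]; abel
  have e3 : x - xm = u - w := by rw [hu, hw]; abel
  have e4 : lam • v + y - x = lam • v + w := by rw [hw]; abel
  rw [e1, inner_sub_left, real_inner_smul_left, real_inner_self_eq_norm_sq] at h1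
  rw [e4] at he
  rw [e2, e3, norm_sub_sq_real u, norm_sub_sq_real u, inner_add_right, real_inner_smul_right,
    real_inner_comm v u]
  nlinarith [mul_le_mul_of_nonneg_left h1 hl.le]

theorem IsStaticChoice.mul_norm_sub_sq_le (hc : IsStaticChoice B x₀ σ μ x lam y b ε)
    (hμ : 0 ≤ μ) (hxm : -(μ • (xm - x₀)) ∈ B xm) :
    (1 - σ ^ 2) * ‖y - x‖ ^ 2 ≤ ‖x - xm‖ ^ 2 := by
  have h := hc.norm_sq_next_add_le hxm
  have h1 : 0 ≤ 2 * lam * μ * ‖y - xm‖ ^ 2 := by have := hc.lam_pos; positivity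
  nlinarith [sq_nonneg ‖x - lam • (b + μ • (y - x₀)) - xm‖]

/-- Linear rate of convergence to the regularized zero. -/
theorem IsStaticChoice.norm_sq_next_le (hc : IsStaticChoice B x₀ σ μ x lam y b ε)
    (hσ : σ ^ 2 < 1) (hμ : 0 < μ) (hxm : -(μ • (xm - x₀)) ∈ B xm) {l : ℝ} (hl : 0 < l)
    (hlam : l ≤ lam) :
    ‖x - lam • (b + μ • (y - x₀)) - xm‖ ^ 2 ≤
      (1 - (1 / (1 - σ ^ 2) + 1 / (2 * l * μ))⁻¹) * ‖x - xm‖ ^ 2 := by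
  have h := hc.norm_sq_next_add_le hxm
  set a' := 1 - σ ^ 2 with ha'
  have ha : 0 < a' := by rw [ha']; linarith
  have hb : 0 < 2 * l * μ := by positivity
  have hb2 : 2 * l * μ * ‖y - xm‖ ^ 2 ≤ 2 * lam * μ * ‖y - xm‖ ^ 2 := by gcongr
  set b' := 2 * l * μ with hb'
  have h3 : ‖x - xm‖ ≤ ‖y - x‖ + ‖y - xm‖ := by
    rw [← norm_neg (y - x)]
    refine le_trans (le_of_eq ?_) (norm_add_le _ _)
    congr 1; abel
  have h4 : ‖x - xm‖ ^ 2 ≤ (‖y - x‖ + ‖y - xm‖) ^ 2 := by gcongr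
  have e : (1 / a' + 1 / b')⁻¹ = a' * b' / (a' + b') := by
    field_simp; rw [add_comm]
  have h5 : a' * b' / (a' + b') * ‖x - xm‖ ^ 2 ≤ a' * ‖y - x‖ ^ 2 + b' * ‖y - xm‖ ^ 2 := by
    rw [div_mul_eq_mul_div, div_le_iff₀ (by positivity)]
    have := mul_le_mul_of_nonneg_left h4 (mul_pos ha hb).le
    -- With `u = ‖y - x‖` and `w = ‖y - xm‖`, the identity is `(a' + b') * (a' * u ^ 2 + b' * w ^ 2)
    -- - a' * b' * (u + w) ^ 2 = (a' * u - b' * w) ^ 2`.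
    nlinarith [sq_nonneg (a' * ‖y - x‖ - b' * ‖y - xm‖)]
  rw [e]
  linarith

theorem IsStaticChoice.mul_norm_residual_le (hc : IsStaticChoice B x₀ σ μ x lam y b ε)
    (hσ : 0 ≤ σ) : lam * ‖b + μ • (y - x₀)‖ ≤ (1 + σ) * ‖y - x‖ := by
  obtain ⟨hl, hε, -, he⟩ := hc
  have h1 : ‖lam • (b + μ • (y - x₀)) + y - x‖ ≤ σ * ‖y - x‖ := by
    refine (sq_le_sq₀ (norm_nonneg _) (by positivity)).1 ?_
    rw [mul_pow]
    have : 0 ≤ 2 * lam * ε := by positivity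
    linarith
  have h2 : lam * ‖b + μ • (y - x₀)‖ = ‖lam • (b + μ • (y - x₀))‖ := by
    rw [norm_smul, Real.norm_of_nonneg hl.le]
  have e : lam • (b + μ • (y - x₀)) = (lam • (b + μ • (y - x₀)) + y - x) - (y - x) := by abel
  have h3 := norm_sub_le (lam • (b + μ • (y - x₀)) + y - x) (y - x)
  rw [← e, ← h2] at h3
  linarith

theorem IsStaticChoice.mul_eps_le (hc : IsStaticChoice B x₀ σ μ x lam y b ε) :
    2 * lam * ε ≤ σ ^ 2 * ‖y - x‖ ^ 2 := by
  have := hc.error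
  nlinarith [sq_nonneg ‖lam • (b + μ • (y - x₀)) + y - x‖]

/-- If the termination test of the static method fails, the distance of the current iterate to the
regularized zero is not small. -/
theorem IsStaticChoice.lt_of_test (hc : IsStaticChoice B x₀ σ μ x lam y b ε) (hσ : 0 ≤ σ)
    (hσ1 : σ < 1) (hμ : 0 ≤ μ) (hxm : -(μ • (xm - x₀)) ∈ B xm) {l ρ εtol c : ℝ} (hl : 0 < l)
    (hlam : l ≤ lam) (hρ : 0 < ρ) (hε : 0 < εtol) (hσc : (1 - σ)⁻¹ ≤ c)
    (test : ρ < ‖b + μ • (y - x₀)‖ ∨ εtol < ε) :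
    (l * ρ) ^ 2 < 2 * c * ‖x - xm‖ ^ 2 ∨ l * εtol < c * ‖x - xm‖ ^ 2 := by
  have h1 := hc.mul_norm_sub_sq_le hμ hxm
  have hs : 0 < 1 - σ := by linarith
  have hc1 : 1 ≤ c * (1 - σ) := by
    rwa [inv_le_iff_one_le_mul₀ hs] at hσc
  have hc0 : 0 < c := by
    by_contra! h
    nlinarith
  have h2 : (1 + σ) * ‖y - x‖ ^ 2 ≤ c * ‖x - xm‖ ^ 2 := by
    have e : c * ((1 - σ ^ 2) * ‖y - x‖ ^ 2) = c * (1 - σ) * ((1 + σ) * ‖y - x‖ ^ 2) := by ring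
    have h3 : 0 ≤ (1 + σ) * ‖y - x‖ ^ 2 := by positivity
    nlinarith [mul_le_mul_of_nonneg_left h1 hc0.le]
  rcases test with test | test
  · left
    have h3 := hc.mul_norm_residual_le hσ
    have h4 : l * ρ < (1 + σ) * ‖y - x‖ := by
      refine lt_of_lt_of_le ?_ h3
      exact lt_of_le_of_lt (mul_le_mul_of_nonneg_right hlam hρ.le)
        (mul_lt_mul_of_pos_left test hc.lam_pos)
    have h5 : (l * ρ) ^ 2 < ((1 + σ) * ‖y - x‖) ^ 2 := by gcongr
    have h6 : 0 ≤ c * ‖x - xm‖ ^ 2 := by positivity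
    nlinarith
  · right
    have h3 := hc.mul_eps_le
    have h4 : l * εtol < lam * ε :=
      lt_of_le_of_lt (mul_le_mul_of_nonneg_right hlam hε.le)
        (mul_lt_mul_of_pos_left test hc.lam_pos)
    have h5 : 0 < lam * ε := lt_trans (by positivity) h4
    have h6 : σ ^ 2 * ‖y - x‖ ^ 2 ≤ (1 + σ) * ‖y - x‖ ^ 2 := by
      gcongr; nlinarith
    linarith

/-- The trial points stay in a ball around the starting point. -/
theorem IsStaticChoice.norm_sub_start_le (hc : IsStaticChoice B x₀ σ μ x lam y b ε)
    (hσ : σ ^ 2 < 1) (hμ : 0 ≤ μ) (hxm : -(μ • (xm - x₀)) ∈ B xm) {d : ℝ}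
    (hd : ‖xm - x₀‖ ≤ d) (hx : ‖x - xm‖ ≤ d) :
    ‖y - x₀‖ ≤ 2 * ((1 + 1 / √(1 - σ ^ 2)) * d) := by
  have h1 := hc.mul_norm_sub_sq_le hμ hxm
  have hs : 0 < √(1 - σ ^ 2) := Real.sqrt_pos.2 (by linarith)
  have hd0 : 0 ≤ d := (norm_nonneg _).trans hd
  have h2 : √(1 - σ ^ 2) * ‖y - x‖ ≤ d := by
    refine le_trans ((sq_le_sq₀ (by positivity) (norm_nonneg _)).1 ?_) hx
    rwa [mul_pow, Real.sq_sqrt (by linarith)]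
  have h3 : ‖y - x‖ ≤ 1 / √(1 - σ ^ 2) * d := by
    rw [div_mul_eq_mul_div, one_mul, le_div_iff₀ hs]; linarith
  have h4 : ‖y - x₀‖ ≤ ‖y - x‖ + ‖x - xm‖ + ‖xm - x₀‖ := by
    have e : y - x₀ = (y - x) + (x - xm) + (xm - x₀) := by abel
    rw [e]; exact norm_add₃_le
  have h5 : 0 ≤ 1 / √(1 - σ ^ 2) * d := by positivity
  linarith

end StaticMethod

/-! ### From geometric decay to a logarithmic count -/

/-- If a geometrically decaying quantity is still above one of two thresholds, then the number of
steps is bounded by a logarithm. -/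
theorem mul_le_of_decay {c θ d r e : ℝ} (k : ℕ) (hc : 1 ≤ c) (hθ1 : θ ≤ 1)
    (hr : 0 < r) (he : 0 < e)
    (h : r ^ 2 < 2 * c * ((1 - θ) ^ k * d ^ 2) ∨ e < c * ((1 - θ) ^ k * d ^ 2)) (hd : 0 ≤ d) :
    k * θ ≤ 2 * c * (1 + max (Real.posLog (d / r)) (Real.posLog (d ^ 2 / e))) := by
  have hexp : (1 - θ) ^ k ≤ Real.exp (-(k * θ)) := by
    rw [← mul_neg, Real.exp_nat_mul]
    exact pow_le_pow_left₀ (by linarith) (Real.one_sub_le_exp_neg θ) k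
  set M := max (Real.posLog (d / r)) (Real.posLog (d ^ 2 / e))
  have hM : 0 ≤ M := le_max_of_le_left Real.posLog_nonneg
  have hdpos : 0 < d := by
    refine hd.lt_of_ne ?_
    rintro rfl
    rcases h with h | h
    · nlinarith [sq_nonneg r]
    · nlinarith
  have hcM : M ≤ c * M := le_mul_of_one_le_left hM hc
  rcases h with h | h
  · have h1 : r ^ 2 < 2 * c * (Real.exp (-(k * θ)) * d ^ 2) := h.trans_le (by gcongr)
    have h2 : Real.exp (k * θ) ≤ 2 * c * (d / r) ^ 2 := by
      rw [Real.exp_neg] at h1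
      rw [div_pow, mul_div_assoc', le_div_iff₀ (by positivity)]
      have := Real.exp_pos (k * θ)
      have h3 := mul_le_mul_of_nonneg_left h1.le this.le
      refine h3.trans (le_of_eq ?_)
      field_simp
    have h3 := Real.log_le_log (Real.exp_pos _) h2
    rw [Real.log_exp, Real.log_mul (by positivity) (by positivity), Real.log_pow] at h3
    -- The constant inside the logarithm is absorbed: `2 * M + 2 * c - 1 ≤ 2 * c * (1 + M)`.
    have h4 := Real.log_le_sub_one_of_pos (show 0 < 2 * c by positivity)
    have h5 : Real.log (d / r) ≤ M := (le_max_right _ _).trans (le_max_left _ _)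
    push_cast at h3
    linarith
  · have h1 : e < c * (Real.exp (-(k * θ)) * d ^ 2) := h.trans_le (by gcongr)
    have h2 : Real.exp (k * θ) ≤ c * (d ^ 2 / e) := by
      rw [Real.exp_neg] at h1
      rw [mul_div_assoc', le_div_iff₀ (by positivity)]
      have := Real.exp_pos (k * θ)
      have h3 := mul_le_mul_of_nonneg_left h1.le this.le
      refine h3.trans (le_of_eq ?_)
      field_simp
    have h3 := Real.log_le_log (Real.exp_pos _) h2
    rw [Real.log_exp, Real.log_mul (by positivity) (by positivity)] at h3
    have h4 := Real.log_le_sub_one_of_pos (show 0 < c by positivity)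
    have h5 : Real.log (d ^ 2 / e) ≤ M := (le_max_right _ _).trans (le_max_right _ _)
    linarith

/-! ### Arithmetic of the guesses and rates -/

namespace DRInput

variable {X : Type*} {P : DRInput X}

theorem Valid.sq_lt_one (hP : P.Valid) : P.σ ^ 2 < 1 := by
  nlinarith [hP.σ_nonneg, hP.σ_lt_one]

theorem Valid.initGuess_pos (hP : P.Valid) : 0 < P.initGuess := by
  have h1 : 0 < 1 - P.σ ^ 2 := by linarith [hP.sq_lt_one]
  have h2 : 0 < P.rhoBar - P.rho := by linarith [hP.rho_lt]
  have h3 := hP.lamBar_pos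
  unfold initGuess
  positivity

theorem Valid.mu_pos (hP : P.Valid) {D : ℝ} (hD : 0 < D) : 0 < P.mu D := by
  have h2 : 0 < P.rhoBar - P.rho := by linarith [hP.rho_lt]
  unfold mu
  positivity

/-- The `j`-th value of the regularization parameter. -/
theorem Valid.mu_two_pow_mul (hP : P.Valid) (j : ℕ) :
    P.mu (2 ^ j * P.initGuess) = (1 - P.σ ^ 2) / (2 ^ j * (2 * P.lamBar)) := by
  have h1 : 0 < 1 - P.σ ^ 2 := by linarith [hP.sq_lt_one]
  have h2 : 0 < P.rhoBar - P.rho := by linarith [hP.rho_lt]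
  have h3 := hP.lamBar_pos
  have h4 : 0 < 1 + 1 / √(1 - P.σ ^ 2) := by positivity
  unfold mu initGuess
  set q := 1 + 1 / √(1 - P.σ ^ 2)
  set a := 1 - P.σ ^ 2
  set t := P.rhoBar - P.rho
  field_simp

/-- With `s = √(1 - σ ^ 2) ≤ 1`, the denominator of `initGuess` is `s ^ 2 + s ≤ 2`, so the initial
guess is at least `lamBar * (rhoBar - rho)`. -/
theorem Valid.two_pow_le (hP : P.Valid) {j : ℕ} {d : ℝ}
    (h : 2 ^ j * P.initGuess < 4 * d) :
    (2 : ℝ) ^ j ≤ 4 * (d / (P.lamBar * (P.rhoBar - P.rho)) + 1) := by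
  have h1 : 0 < 1 - P.σ ^ 2 := by linarith [hP.sq_lt_one]
  have h2 : 0 < P.rhoBar - P.rho := by linarith [hP.rho_lt]
  have h3 := hP.lamBar_pos
  have hle : P.lamBar * (P.rhoBar - P.rho) ≤ P.initGuess := by
    set s := √(1 - P.σ ^ 2) with hs
    have hs0 : 0 < s := Real.sqrt_pos.2 h1
    have hss : s ^ 2 = 1 - P.σ ^ 2 := Real.sq_sqrt h1.le
    have hs1 : s ≤ 1 := by nlinarith [sq_nonneg P.σ]
    have e : (1 - P.σ ^ 2) * (1 + 1 / s) = s ^ 2 + s := by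
      rw [← hss]; field_simp
    unfold initGuess
    rw [← hs, e, le_div_iff₀ (by positivity)]
    have : s ^ 2 + s ≤ 2 := by nlinarith
    nlinarith [mul_pos h3 h2]
  have h4 : 2 ^ j * (P.lamBar * (P.rhoBar - P.rho)) ≤ 4 * d :=
    (mul_le_mul_of_nonneg_left hle (by positivity)).trans h.le
  rw [← le_div_iff₀ (by positivity)] at h4
  refine h4.trans ?_
  rw [mul_div_assoc]
  linarith

/-- The linear rate `θ` of the call of the static method with guess `D`, when the stepsizes are at
least `l`. -/
noncomputable def rate (P : DRInput X) (l D : ℝ) : ℝ :=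
  (1 / (1 - P.σ ^ 2) + 1 / (2 * l * P.mu D))⁻¹

/-- The choice of `initGuess` cancels `rhoBar - rho` and the square root from `μ`, leaving growth in
`2 ^ j` only. -/
theorem Valid.inv_rate (hP : P.Valid) {l : ℝ} (hl : 0 < l) (j : ℕ) :
    (P.rate l (2 ^ j * P.initGuess))⁻¹ = 1 / (1 - P.σ ^ 2) * (1 + 2 ^ j * (P.lamBar / l)) := by
  have h1 : 0 < 1 - P.σ ^ 2 := by linarith [hP.sq_lt_one]
  have h3 := hP.lamBar_pos
  rw [rate, inv_inv, hP.mu_two_pow_mul]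
  field_simp

theorem Valid.one_le_inv_rate (hP : P.Valid) {l : ℝ} (hl : 0 < l) (j : ℕ) :
    1 ≤ (P.rate l (2 ^ j * P.initGuess))⁻¹ := by
  have h1 : 0 < 1 - P.σ ^ 2 := by linarith [hP.sq_lt_one]
  have h3 := hP.lamBar_pos
  rw [hP.inv_rate hl]
  refine one_le_mul_of_one_le_of_one_le ?_ ?_
  · rw [le_div_iff₀ h1]; nlinarith [sq_nonneg P.σ]
  · have : 0 ≤ 2 ^ j * (P.lamBar / l) := by positivity
    linarith

theorem Valid.inv_rate_le (hP : P.Valid) {l c : ℝ} (hl : 0 < l) (hc : (1 - P.σ)⁻¹ ≤ c) (j : ℕ) :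
    (P.rate l (2 ^ j * P.initGuess))⁻¹ ≤ c * (2 ^ j * (1 + P.lamBar / l)) := by
  have h1 : 0 < 1 - P.σ ^ 2 := by linarith [hP.sq_lt_one]
  have h2 : 0 < 1 - P.σ := by linarith [hP.σ_lt_one]
  have h3 := hP.lamBar_pos
  rw [hP.inv_rate hl]
  have hc0 : 0 < c := (inv_pos.2 h2).trans_le hc
  have h4 : 1 / (1 - P.σ ^ 2) ≤ c := by
    refine le_trans ?_ hc
    rw [one_div]
    refine inv_anti₀ h2 ?_
    nlinarith [hP.σ_nonneg]
  have h5 : (1 : ℝ) ≤ 2 ^ j := one_le_pow₀ (by norm_num)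
  gcongr
  linarith

/-- The coefficient in the bound on the number of inner iterations of a call. -/
noncomputable def callBound (P : DRInput X) (l c d : ℝ) : ℝ :=
  (2 * c ^ 2 + 2) * ((1 + P.lamBar / l) * (1 + max (Real.posLog (d / (l * P.rho)))
    (Real.posLog (d ^ 2 / (l * P.epsBar)))))

theorem Valid.two_le_callBound (hP : P.Valid) {l c d : ℝ} (hl : 0 < l) :
    2 ≤ P.callBound l c d := by
  have h1 : 0 < P.lamBar / l := div_pos hP.lamBar_pos hl
  have h2 : 0 ≤ max (Real.posLog (d / (l * P.rho))) (Real.posLog (d ^ 2 / (l * P.epsBar))) :=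
    le_max_of_le_left Real.posLog_nonneg
  have h3 : 1 ≤ (1 + P.lamBar / l) * (1 + max (Real.posLog (d / (l * P.rho)))
    (Real.posLog (d ^ 2 / (l * P.epsBar)))) :=
    one_le_mul_of_one_le_of_one_le (by linarith) (by linarith)
  unfold callBound
  nlinarith [sq_nonneg c]

end DRInput

/-! ### The invariant and the total iteration count -/

/-- What is known of a state of DR-HPE after `n` inner iterations: `T * 2 ^ j` bounds the number
of inner iterations of the `j`-th call of the static method, and `R` bounds `2 ^ j`. -/
def DRState.Bounded {X : Type*} [NormedAddCommGroup X] [InnerProductSpace ℝ X]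
    (B : X → Set X) (P : DRInput X) (l d T R : ℝ) (n : ℕ) : DRState X → Prop
  | .running D x => ∃ j k : ℕ, D = 2 ^ j * P.initGuess ∧ (2 : ℝ) ^ j ≤ R ∧
      (n : ℝ) ≤ T * (2 ^ j - 1) + k ∧ (k : ℝ) + 1 ≤ T * 2 ^ j ∧
      ∀ xm, -(P.mu D • (xm - P.x₀)) ∈ B xm → ‖x - xm‖ ^ 2 ≤ (1 - P.rate l D) ^ k * d ^ 2
  | .output y b ε => (n : ℝ) ≤ T * (2 * R) ∧ b ∈ enlargement B ε y ∧ ‖b‖ ≤ P.rhoBar ∧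
      ε ≤ P.epsBar

section DynamicMethod

variable {X : Type*} [NormedAddCommGroup X] [InnerProductSpace ℝ X] {B : X → Set X}
  {P : DRInput X} {l c d : ℝ}

/-- If the `k + 1`-st inner iteration of a call does not finish it, then `k` is bounded. -/
theorem IsStaticChoice.add_two_le (hP : P.Valid) (hl : 0 < l) (hσc : (1 - P.σ)⁻¹ ≤ c)
    (hd : 0 ≤ d) {j k : ℕ} {x y b xm : X} {lam ε : ℝ}
    (hxm : -(P.mu (2 ^ j * P.initGuess) • (xm - P.x₀)) ∈ B xm)
    (hx : ‖x - xm‖ ^ 2 ≤ (1 - P.rate l (2 ^ j * P.initGuess)) ^ k * d ^ 2)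
    (hc : IsStaticChoice B P.x₀ P.σ (P.mu (2 ^ j * P.initGuess)) x lam y b ε) (hlam : l ≤ lam)
    (test : P.rho < ‖b + P.mu (2 ^ j * P.initGuess) • (y - P.x₀)‖ ∨ P.epsBar < ε) :
    (k : ℝ) + 2 ≤ P.callBound l c d * 2 ^ j := by
  have hD : 0 < 2 ^ j * P.initGuess := mul_pos (by positivity) hP.initGuess_pos
  have hc1 : 1 ≤ c := by
    refine le_trans ?_ hσc
    exact (one_le_inv₀ (by linarith [hP.σ_lt_one])).2 (by linarith [hP.σ_nonneg])
  have h1 := hc.lt_of_test hP.σ_nonneg hP.σ_lt_one (hP.mu_pos hD).le hxm hl hlam hP.rho_pos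
    hP.epsBar_pos hσc test
  have hinv1 := hP.one_le_inv_rate hl j
  have hinv := hP.inv_rate_le hl hσc j
  set θ := P.rate l (2 ^ j * P.initGuess)
  have hθ : 0 < θ := inv_pos.1 (by linarith)
  have hθ1 : θ ≤ 1 := (one_le_inv₀ hθ).1 hinv1
  have h2 := mul_le_of_decay k hc1 hθ1 (mul_pos hl hP.rho_pos) (mul_pos hl hP.epsBar_pos)
    (h1.imp (fun h => h.trans_le (by gcongr)) (fun h => h.trans_le (by gcongr))) hd
  have h3 : 0 ≤ max (Real.posLog (d / (l * P.rho))) (Real.posLog (d ^ 2 / (l * P.epsBar))) :=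
    le_max_of_le_left Real.posLog_nonneg
  unfold DRInput.callBound
  set M := max (Real.posLog (d / (l * P.rho))) (Real.posLog (d ^ 2 / (l * P.epsBar)))
  have hr : 0 < P.lamBar / l := div_pos hP.lamBar_pos hl
  set r := P.lamBar / l
  have h4 : (k : ℝ) ≤ 2 * c * (1 + M) * (c * (2 ^ j * (1 + r))) := by
    rw [← le_div_iff₀ hθ, div_eq_mul_inv] at h2
    exact h2.trans (by gcongr)
  have h5 : (1 : ℝ) ≤ 2 ^ j := one_le_pow₀ (by norm_num)
  have h6 : 1 ≤ 2 ^ j * ((1 + r) * (1 + M)) :=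
    one_le_mul_of_one_le_of_one_le h5
      (one_le_mul_of_one_le_of_one_le (by linarith) (by linarith))
  -- The summand `2 * c ^ 2` of the coefficient covers `k`; the other `2`, times the quantity in
  -- `h6`, covers the extra two iterations.
  linarith

/-- A bounded state remains so in an inner iteration. -/
theorem DRStep.bounded [FiniteDimensional ℝ X] (hB : IsMaximalMonotoneOp B) (hP : P.Valid)
    (hl : 0 < l) (hσc : (1 - P.σ)⁻¹ ≤ c) {p : X} (hp : p ∈ zeroSet B)
    {lam : ℝ} (hlam : l ≤ lam) {n : ℕ} {s s' : DRState X} (h : DRStep B P lam s s')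
    (hs : s.Bounded B P l ‖p - P.x₀‖ (P.callBound l c ‖p - P.x₀‖)
      (4 * (‖p - P.x₀‖ / (P.lamBar * (P.rhoBar - P.rho)) + 1)) n) :
    s'.Bounded B P l ‖p - P.x₀‖ (P.callBound l c ‖p - P.x₀‖)
      (4 * (‖p - P.x₀‖ / (P.lamBar * (P.rhoBar - P.rho)) + 1)) (n + 1) := by
  have hT : 2 ≤ P.callBound l c ‖p - P.x₀‖ := hP.two_le_callBound hl
  have hd : 0 ≤ ‖p - P.x₀‖ := norm_nonneg _
  set T := P.callBound l c ‖p - P.x₀‖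
  set d := ‖p - P.x₀‖
  have hclose : ∀ (j : ℕ) (xm : X), -(P.mu (2 ^ j * P.initGuess) • (xm - P.x₀)) ∈ B xm →
      ‖xm - P.x₀‖ ≤ d := fun j xm hxm =>
    hB.1.norm_regularized_zero_sub_le
      (hP.mu_pos (mul_pos (by positivity) hP.initGuess_pos)) hxm hp
  cases h with
  | inner D x x' call =>
    obtain ⟨j, k, rfl, hj, hn, hk, hx⟩ := hs
    have hD : 0 < 2 ^ j * P.initGuess := mul_pos (by positivity) hP.initGuess_pos
    rcases call with ⟨y, b, ε, choice, test⟩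
    · refine ⟨j, k + 1, rfl, hj, ?_, ?_, fun xm hxm => ?_⟩
      · push_cast; linarith
      -- The `+ 1` in the invariant reserves room for the iteration that ends the call, hence `k +
      -- 2` here.
      · obtain ⟨xm, hxm⟩ := hB.exists_regularized_zero ⟨p, hp⟩ (hP.mu_pos hD) P.x₀
        have := choice.add_two_le hP hl hσc hd hxm (hx xm hxm) hlam test
        push_cast; linarith
      · have h1 := choice.norm_sq_next_le hP.sq_lt_one (hP.mu_pos hD) hxm hl hlam
        have hinv1 := hP.one_le_inv_rate hl j
        have hθ : 0 < P.rate l (2 ^ j * P.initGuess) := inv_pos.1 (by linarith)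
        have hθ1 := (one_le_inv₀ hθ).1 hinv1
        have h2 := mul_le_mul_of_nonneg_left (hx xm hxm) (sub_nonneg.2 hθ1)
        rw [← mul_assoc, ← pow_succ'] at h2
        exact h1.trans h2
  | double D x y b ε call test =>
    obtain ⟨j, k, rfl, hj, hn, hk, hx⟩ := hs
    have hD : 0 < 2 ^ j * P.initGuess := mul_pos (by positivity) hP.initGuess_pos
    cases call with
    | finish _ _ _ choice _ =>
      have e : 2 * (2 ^ j * P.initGuess) = 2 ^ (j + 1) * P.initGuess := by ring
      have hpow : (0 : ℝ) < 2 ^ j := by positivity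
      refine ⟨j + 1, 0, e, ?_, ?_, ?_, ?_⟩
      -- The failed test and the ball containing `y` give a current guess below `2 * d`, so the
      -- doubled one is below `4 * d`.
      · refine hP.two_pow_le ?_
        obtain ⟨xm, hxm⟩ := hB.exists_regularized_zero ⟨p, hp⟩ (hP.mu_pos hD) P.x₀
        have hxd : ‖x - xm‖ ≤ d := by
          refine (sq_le_sq₀ (norm_nonneg _) hd).1 ((hx xm hxm).trans ?_)
          have hinv1 := hP.one_le_inv_rate hl j
          have hθ : 0 < P.rate l (2 ^ j * P.initGuess) := inv_pos.1 (by linarith)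
          have hθ1 := (one_le_inv₀ hθ).1 hinv1
          exact mul_le_of_le_one_left (sq_nonneg d)
            (pow_le_one₀ (sub_nonneg.2 hθ1) (by linarith))
        have h1 := choice.norm_sub_start_le hP.sq_lt_one (hP.mu_pos hD).le hxm
          (hclose j xm hxm) hxd
        have h2 := mul_le_mul_of_nonneg_left h1 (hP.mu_pos hD).le
        have h3 := (not_le.1 test).trans_le h2
        have hq : 0 < 1 + 1 / √(1 - P.σ ^ 2) := by positivity
        have ht : 0 < P.rhoBar - P.rho := by linarith [hP.rho_lt]
        rw [DRInput.mu, div_mul_eq_mul_div, lt_div_iff₀ (by positivity)] at h3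
        have h4 := lt_of_mul_lt_mul_left h3 ht.le
        have h5 : (1 + 1 / √(1 - P.σ ^ 2)) * (2 ^ j * P.initGuess) <
            (1 + 1 / √(1 - P.σ ^ 2)) * (2 * d) := by linarith
        have h6 := lt_of_mul_lt_mul_left h5 hq.le
        rw [← e]; linarith
      -- Geometric sum: `T * (2 ^ j - 1) + T * 2 ^ j = T * (2 ^ (j + 1) - 1)`.
      · push_cast; rw [pow_succ]; linarith
      · rw [pow_succ]; push_cast; nlinarith
      · intro xm hxm
        rw [e] at hxm
        have := hclose (j + 1) xm hxm
        rw [pow_zero, one_mul, norm_sub_rev]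
        gcongr
  | finish D x y b ε call test =>
    obtain ⟨j, k, rfl, hj, hn, hk, hx⟩ := hs
    cases call with
    | finish _ _ _ choice test' =>
      push Not at test'
      refine ⟨?_, choice.mem, ?_, test'.2⟩
      · have := mul_le_mul_of_nonneg_left hj (by linarith : 0 ≤ T)
        push_cast
        nlinarith
      · have hD : 0 < 2 ^ j * P.initGuess := mul_pos (by positivity) hP.initGuess_pos
        have h1 := norm_sub_le (b + P.mu (2 ^ j * P.initGuess) • (y - P.x₀))
          (P.mu (2 ^ j * P.initGuess) • (y - P.x₀))
        rw [add_sub_cancel_right, norm_smul, Real.norm_of_nonneg (hP.mu_pos hD).le] at h1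
        linarith [test'.1]

/-- All the states of an execution are bounded. -/
theorem DRExec.bounded [FiniteDimensional ℝ X] (hB : IsMaximalMonotoneOp B) (hP : P.Valid)
    (hl : 0 < l) (hσc : (1 - P.σ)⁻¹ ≤ c) {p : X} (hp : p ∈ zeroSet B)
    {lam : ℕ → ℝ} {n : ℕ} {s : DRState X} (h : DRExec B P lam n s) (hlam : ∀ i < n, l ≤ lam i) :
    s.Bounded B P l ‖p - P.x₀‖ (P.callBound l c ‖p - P.x₀‖)
      (4 * (‖p - P.x₀‖ / (P.lamBar * (P.rhoBar - P.rho)) + 1)) n := by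
  induction h with
  | start =>
    have ht : 0 < P.rhoBar - P.rho := by linarith [hP.rho_lt]
    have hT : 2 ≤ P.callBound l c ‖p - P.x₀‖ := hP.two_le_callBound hl
    have := hP.lamBar_pos
    refine ⟨0, 0, by simp, ?_, by simp, ?_, fun xm hxm => ?_⟩
    · have : 0 ≤ ‖p - P.x₀‖ / (P.lamBar * (P.rhoBar - P.rho)) := by positivity
      linarith
    · push_cast; linarith
    · have := hB.1.norm_regularized_zero_sub_le (hP.mu_pos hP.initGuess_pos) hxm hp
      rw [pow_zero, one_mul, norm_sub_rev]
      gcongr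
  | step n s s' _ next ih =>
    exact next.bounded hB hP hl hσc hp (hlam n n.lt_succ_self)
      (ih fun i hi => hlam i (hi.trans n.lt_succ_self))

/-- As long as DR-HPE has not stopped, it can go on, with any prescribed stepsize. -/
theorem exists_dRStep [FiniteDimensional ℝ X] (hB : IsMaximalMonotoneOp B)
    (hne : (zeroSet B).Nonempty) (hP : P.Valid) (hl : 0 < l) {D : ℝ} (hD : 0 < D) (x : X) :
    ∃ s', DRStep B P l (.running D x) s' := by
  obtain ⟨y, b, choice⟩ := hB.exists_isStaticChoice hne (hP.mu_pos hD) hl P.x₀ x P.σ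
  by_cases h1 : P.rho < ‖b + P.mu D • (y - P.x₀)‖ ∨ P.epsBar < 0
  · exact ⟨_, .inner D x _ (.continue y b 0 choice h1)⟩
  by_cases h2 : P.mu D * ‖y - P.x₀‖ ≤ P.rhoBar - P.rho
  · exact ⟨_, .finish D x y b 0 (.finish y b 0 choice h1) h2⟩
  · exact ⟨_, .double D x y b 0 (.finish y b 0 choice h1) h2⟩

end DynamicMethod

/-- For each bound `c` on `(1 - σ)⁻¹` there is a constant `C`, depending on `c` only, such that
every execution of DR-HPE whose stepsizes are at least `lamLow` has the stated number of inner
iterations at most, and has either stopped with a triple as required, or can be continued by an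
inner iteration; so every execution that is carried on until it stops finds such a triple. -/
theorem theorem3p4 (c : ℝ) :
    ∃ C : ℝ, 0 < C ∧
      ∀ (X : Type*) [NormedAddCommGroup X] [InnerProductSpace ℝ X] [FiniteDimensional ℝ X]
        (B : X → Set X) (P : DRInput X) (lamLow : ℝ) (lam : ℕ → ℝ) (n : ℕ) (s : DRState X),
        IsMaximalMonotoneOp B → (zeroSet B).Nonempty →
        P.Valid → (1 - P.σ)⁻¹ ≤ c → 0 < lamLow →
        DRExec B P lam n s → (∀ i < n, lamLow ≤ lam i) →
        (n : ℝ) ≤ C * ((1 + P.lamBar / lamLow) *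
            (Metric.infDist P.x₀ (zeroSet B) / (P.lamBar * (P.rhoBar - P.rho)) + 1) *
            (1 + max
              (Real.posLog (Metric.infDist P.x₀ (zeroSet B) / (lamLow * P.rho)))
              (Real.posLog (Metric.infDist P.x₀ (zeroSet B) ^ 2 / (lamLow * P.epsBar))))) ∧
        ((∃ (y b : X) (ε : ℝ), s = DRState.output y b ε ∧
            b ∈ enlargement B ε y ∧ ‖b‖ ≤ P.rhoBar ∧ ε ≤ P.epsBar) ∨
          (∃ (D : ℝ) (x : X), s = DRState.running D x ∧
            ∃ (l : ℝ) (s' : DRState X), lamLow ≤ l ∧ DRStep B P l s s')) := by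
  -- The product of `2 * c ^ 2 + 2` from `callBound`, `4` from the bound on `2 ^ j`, and `2` from
  -- the geometric sum.
  refine ⟨16 * (c ^ 2 + 1), by positivity, ?_⟩
  intro X _ _ _ B P l lam n s hB hne hP hσc hl hexec hlam
  have : ProperSpace X := FiniteDimensional.proper ℝ X
  -- The reference zero `p` is a nearest one, so that `‖p - P.x₀‖` is exactly `d₀`.
  obtain ⟨p, hp, hdist⟩ := hB.isClosed_zeroSet.exists_infDist_eq_dist hne P.x₀
  rw [dist_comm, dist_eq_norm] at hdist
  have hbd := hexec.bounded hB hP hl hσc hp hlam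
  have hT : 2 ≤ P.callBound l c ‖p - P.x₀‖ := hP.two_le_callBound hl
  have hfinal : P.callBound l c ‖p - P.x₀‖ *
      (2 * (4 * (‖p - P.x₀‖ / (P.lamBar * (P.rhoBar - P.rho)) + 1))) =
      16 * (c ^ 2 + 1) * ((1 + P.lamBar / l) *
            (‖p - P.x₀‖ / (P.lamBar * (P.rhoBar - P.rho)) + 1) *
            (1 + max (Real.posLog (‖p - P.x₀‖ / (l * P.rho)))
              (Real.posLog (‖p - P.x₀‖ ^ 2 / (l * P.epsBar))))) := by
    unfold DRInput.callBound
    ring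
  rw [hdist, ← hfinal]
  cases s with
  | running D x =>
    obtain ⟨j, k, rfl, hj, hn, hk, -⟩ := hbd
    have hD : 0 < 2 ^ j * P.initGuess := mul_pos (by positivity) hP.initGuess_pos
    refine ⟨?_, Or.inr ⟨_, x, rfl, ?_⟩⟩
    · have := mul_le_mul_of_nonneg_left hj (by linarith : 0 ≤ P.callBound l c ‖p - P.x₀‖)
      linarith
    · obtain ⟨s', hs'⟩ := exists_dRStep hB hne hP hl hD x
      exact ⟨l, s', le_rfl, hs'⟩
  | output y b ε =>
    obtain ⟨hn, h⟩ := hbd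
    exact ⟨hn, Or.inl ⟨y, b, ε, rfl, h⟩⟩
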